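/- **Setting.** Let $\mathcal{E}$ be a set of events, $\mathcal{E}^*$ the set of finite sequences of events, and $\varepsilon\in\mathcal{E}^*$ the empty sequence. Let $\Delta(\mathcal{E}^*)$ be the set of lotteries, i.e. finitely supported probability distributions on $\mathcal{E}^*$; a sequence is identified with its Dirac lottery. For $e\in\mathcal{E}$ and a lottery $p$, $e\cdot p$ is the lottery obtained from $p$ by prepending $e$ to every sequence. Let $\succsim$ be a binary relation on $\Delta(\mathcal{E}^*)$; write $p\succ q$ (or $q\prec p$) for $\neg(q\succsim p)$ and $p\approx q$ for $p\succsim q$ and $q\succsim p$. Fix an outcome $o^\dagger\in\mathcal{E}^*$, and let $\mathcal{O}_{\mathrm{safe}}=\{o\in\mathcal{E}^* : o\not\approx o^\dagger\}$, with $\Delta(\mathcal{O}_{\mathrm{safe}})$ the set of lotteries supported in $\mathcal{O}_{\mathrm{safe}}$. Suppose that the empty sequence is safe, $\varepsilon\in\mathcal{O}_{\mathrm{safe}}$. Let $\mathcal{E}^\dagger=\{e\in\mathcal{E} : e\approx o^\dagger\}$ and $\mathcal{E}_{\mathrm{term}}=\{e\in\mathcal{E} : e\cdot p\approx e\cdot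 q \text{ for all lotteries } p,q\}$. **Assumption 1.** - Completeness: for all lotteries $p,q$, $p\succsim q$ or $q\succsim p$. - Transitivity: $p\succsim q$ and $q\succsim s$ imply $p\succsim s$. - Independence: for all lotteries $p,q,s$ and $\alpha\in[0,1)$, $\alpha p+(1-\alpha)q\succsim\alpha p+(1-\alpha)s \iff q\succsim s$. - Continuity on safe lotteries: for $p,q,s\in\Delta(\mathcal{O}_{\mathrm{safe}})$ with $p\succsim q\succsim s$ there is $\alpha\in[0,1]$ with $\alpha p+(1-\alpha)s\approx q$. - Safety First: for all $p,q\in\Delta(\mathcal{O}_{\mathrm{safe}})$ and $\delta\in(0,1]$, $\delta o^\dagger+(1-\delta)p\prec q$. - Non-triviality: there are $o_1,o_2\in\mathcal{O}_{\mathrm{safe}}$ with $o_1\not\approx o_2$. **Memorylessness.** For every $e\in\mathcal{E}$, either ($e\cdot p\succsim e\cdot q\iff p\succsim q$ for all lotteries $p,q$) or $e\in\mathcal{E}_{\mathrm{term}}$. **Theorem.** The relation $\succsim$ (with $o^\dagger$) satisfies Assumption 1 and Memorylessness if and only if there exist rewards $r:\mathcal{E}\to\mathbb{R}$, multipliers $\gamma:\mathcal{E}\to(0,\infty)$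 and a function $u=(u_1,u_2):\Delta(\mathcal{E}^*)\to\mathbb{R}^2$ such that 1. $u$ is linear, $u(p)=\sum_{o}p(o)u(o)$ for every lottery $p$, and is a lexicographic utility: $u(p)\ge_{\mathrm{lex}}u(q)\iff p\succsim q$ for all lotteries $p,q$; 2. $u(\varepsilon)=(0,0)$ and $u(o^\dagger)=(-1,0)$, and $u$ is not constant on $\mathcal{O}_{\mathrm{safe}}$; 3. for all $e\in\mathcal{E}$ and $\tau\in\mathcal{E}^*$, $$u(e\cdot\tau)=\begin{cases}(0,\,r(e)) & e\in\mathcal{E}_{\mathrm{term}}\setminus\mathcal{E}^\dagger,\\ (-1,\,0) & e\in\mathcal{E}^\dagger,\\ \bigl(u_1(\tau),\ (1+u_1(\tau))\,r(e)+\gamma(e)\,u_2(\tau)\bigr) & \text{otherwise.}\end{cases}$$ -/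

import Mathlib

open Convexity

noncomputable section

namespace LexEUT

/-- Lotteries over a set of outcomes: finitely supported probability distributions. -/
abbrev Lottery (O : Type*) := StdSimplex ℝ O

/-- A (weak) preference relation on lotteries; `R p q` reads `p ≿ q`. -/
abbrev Preference (O : Type*) := Lottery O → Lottery O → Prop

section General

variable {O : Type*}

/-- The Dirac lottery at an outcome. -/
def dirac (o : O) : Lottery O := StdSimplex.single o

/-- The compound lottery `α p + (1 - α) q`, for `α ∈ [0, 1]`. -/
def mix (α : ℝ) (hα : α ∈ Set.Icc (0 : ℝ) 1) (p q : Lottery O) : Lottery O :=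
  convexCombPair α (1 - α) hα.1 (sub_nonneg.2 hα.2) (add_sub_cancel α 1) p q

/-- The set `Δ(S)` of lotteries that only charge outcomes in `S`. -/
def lotteriesOn (S : Set O) : Set (Lottery O) := {p | (p.weights.support : Set O) ⊆ S}

/-- Strict preference: `p ≻ q` means not `q ≿ p`. -/
def Strict (R : Preference O) (p q : Lottery O) : Prop := ¬ R q p

/-- Indifference: `p ≈ q`. -/
def Indiff (R : Preference O) (p q : Lottery O) : Prop := R p q ∧ R q p

def Completeness (R : Preference O) : Prop := ∀ p q, R p q ∨ R q p

def Transitivity (R : Preference O) : Prop := ∀ p q r, R p q → R q r → R p r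

def Independence (R : Preference O) : Prop :=
  ∀ (p q r : Lottery O) (α : ℝ) (hα : α ∈ Set.Icc (0 : ℝ) 1), α < 1 →
    (R (mix α hα p q) (mix α hα p r) ↔ R q r)

/-- Continuity of the relation restricted to a set `D` of lotteries. -/
def ContinuityOn (R : Preference O) (D : Set (Lottery O)) : Prop :=
  ∀ p ∈ D, ∀ q ∈ D, ∀ r ∈ D, R p q → R q r →
    ∃ (α : ℝ) (hα : α ∈ Set.Icc (0 : ℝ) 1), Indiff R (mix α hα p r) q

/-- The safe outcomes: those that are not indifferent to the unsafe outcome `od`. -/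
def safeOutcomes (R : Preference O) (od : O) : Set O :=
  {o | ¬ Indiff R (dirac o) (dirac od)}

/-- Safety First: any positive probability of the unsafe outcome `od`, mixed into any safe
lottery, is strictly worse than every safe lottery. -/
def SafetyFirst (R : Preference O) (od : O) : Prop :=
  ∀ p ∈ lotteriesOn (safeOutcomes R od), ∀ q ∈ lotteriesOn (safeOutcomes R od),
    ∀ (ε : ℝ) (hε : ε ∈ Set.Icc (0 : ℝ) 1), 0 < ε →
      Strict R q (mix ε hε (dirac od) p)

/-- The assumptions for a single unsafe utility, with unsafe outcome `od`. -/
structure SingleUnsafe (R : Preference O) (od : O) : Prop where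
  complete : Completeness R
  trans : Transitivity R
  indep : Independence R
  cont_safe : ContinuityOn R (lotteriesOn (safeOutcomes R od))
  safety : SafetyFirst R od
  nontrivial : ∃ o₁ ∈ safeOutcomes R od, ∃ o₂ ∈ safeOutcomes R od,
    ¬ Indiff R (dirac o₁) (dirac o₂)

/-- A `d`-dimensional lexicographic utility function for `R`; the first coordinate has the
highest priority. -/
def IsLexUtility {d : ℕ} (R : Preference O) (u : Lottery O → Fin d → ℝ) : Prop :=
  ∀ p q, toLex (u p) ≥ toLex (u q) ↔ R p q

/-- Linearity: `u(p) = ∑ₒ p(o) u(o)`. -/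
def IsLinearUtility {d : ℕ} (u : Lottery O → Fin d → ℝ) : Prop :=
  ∀ p, u p = p.weights.sum fun o w => w • u (dirac o)

end General

section Sequential

/- Outcomes are finite sequences of events, i.e. elements of `List E`; the empty sequence is `[]`
and prepending `e` to `τ` gives `e :: τ`. -/
variable {E : Type*}

/-- The concatenation `e · p` of an event and a lottery over sequences. -/
def prepend (e : E) (p : Lottery (List E)) : Lottery (List E) := p.map (List.cons e)

/-- Prepending `e` preserves (and reflects) preferences. -/
def Retains (R : Preference (List E)) (e : E) : Prop :=
  ∀ p q, R (prepend e p) (prepend e q) ↔ R p q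

/-- The terminal events: those that make all continuations indifferent. -/
def terminalEvents (R : Preference (List E)) : Set E :=
  {e | ∀ p q, Indiff R (prepend e p) (prepend e q)}

def Memorylessness (R : Preference (List E)) : Prop :=
  ∀ e, Retains R e ∨ e ∈ terminalEvents R

/-- The unsafe events: those that, as one-term sequences, are indifferent to `od`. -/
def unsafeEvents (R : Preference (List E)) (od : List E) : Set E :=
  {e | Indiff R (dirac [e]) (dirac od)}

/-- The three-case recursion for the utility of `e · τ`; `u · 0` and `u · 1` are the first and
the second coordinate. -/
def SafeRecursion (R : Preference (List E)) (od : List E) (r γ : E → ℝ)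
    (u : Lottery (List E) → Fin 2 → ℝ) : Prop :=
  ∀ (e : E) (τ : List E),
    (e ∈ terminalEvents R \ unsafeEvents R od → u (dirac (e :: τ)) = ![0, r e]) ∧
    (e ∈ unsafeEvents R od → u (dirac (e :: τ)) = ![-1, 0]) ∧
    (e ∉ terminalEvents R ∧ e ∉ unsafeEvents R od →
      u (dirac (e :: τ)) =
        ![u (dirac τ) 0, (1 + u (dirac τ) 0) * r e + γ e * u (dirac τ) 1])

end Sequential

end LexEUT

end

noncomputable section

namespace LexEUT

/-! By Independence, preference depends only on the signed measure `p - q`: such differences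
generate a convex cone (`sub_mem_prefCone_iff`), whose lineality space `L` consists of the
indifferent directions. Continuity makes differences of safe lotteries one-dimensional modulo `L`
(`exists_sub_smul_sub_mem`), spanned by a strict `d = o₁ - o₂`. Safety First puts `b = ε - o†` above
every multiple of `d`. Hence mass-zero measures modulo `L` are a plane ordered lexicographically in
the basis `b`, `d`, and the coordinates are the utility (`SingleUnsafe.exists_lexUtility`).

The recursion comes from prepending a retaining event `e`, which acts linearly and preserves the
cone, hence `L`. Applied to `τ - ε ≡ u₂(τ) d` for safe `τ`, it gives `u₂(e·τ) = r(e) + γ(e) u₂(τ)`,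
with `γ(e)` the increment of `u₂` along `e·d`. Unsafe sequences stay unsafe
(`Retains.cons_od_notMem`).

Conversely, the recursion gives safe outcomes first coordinate `0`, and its third case acts on
utilities by a map that is strictly increasing for the lexicographic order. -/

lemma toLex_ge_iff (a b : Fin 2 → ℝ) :
    toLex a ≥ toLex b ↔ b 0 < a 0 ∨ (b 0 = a 0 ∧ b 1 ≤ a 1) := by
  rw [ge_iff_le, le_iff_lt_or_eq]
  constructor
  · rintro (⟨i, hi, hlt⟩ | h)
    · fin_cases i
      · exact Or.inl hlt
      · exact Or.inr ⟨hi 0 (by simp), le_of_lt hlt⟩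
    · have h' : b = a := toLex.injective h
      subst h'
      exact Or.inr ⟨rfl, le_rfl⟩
  · rintro (h | ⟨h0, h1⟩)
    · refine Or.inl ⟨0, ?_, h⟩
      intro j hj
      exact absurd hj (by simp)
    · rcases h1.lt_or_eq with h1 | h1
      · refine Or.inl ⟨1, ?_, h1⟩
        intro j hj
        fin_cases j
        · exact h0
        · exact absurd hj (lt_irrefl _)
      · right
        congr 1
        ext i
        fin_cases i
        · exact h0
        · exact h1

/-! ### The preference cone and its lineality space -/

section Cone

variable {O : Type*} {R : Preference O}

lemma lottery_ext {p q : Lottery O} (h : p.weights = q.weights) : p = q := StdSimplex.ext h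

@[simp] lemma weights_dirac (o : O) : (dirac o).weights = Finsupp.single o 1 := rfl

@[simp] lemma weights_mix (α : ℝ) (hα : α ∈ Set.Icc (0 : ℝ) 1) (p q : Lottery O) :
    (mix α hα p q).weights = α • p.weights + (1 - α) • q.weights := by
  simp [mix]

lemma mix_mem_lotteriesOn {S : Set O} {α : ℝ} {hα : α ∈ Set.Icc (0 : ℝ) 1} {p q : Lottery O}
    (hp : p ∈ lotteriesOn S) (hq : q ∈ lotteriesOn S) : mix α hα p q ∈ lotteriesOn S := by
  classical
  intro o ho
  by_contra hS
  have h1 : p.weights o = 0 := by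
    by_contra h
    exact hS (hp (by simpa using h))
  have h2 : q.weights o = 0 := by
    by_contra h
    exact hS (hq (by simpa using h))
  simp [h1, h2] at ho

lemma dirac_mem_lotteriesOn {S : Set O} {o : O} (ho : o ∈ S) : dirac o ∈ lotteriesOn S := by
  classical
  intro x hx
  have : x = o := by
    by_contra h
    exact (Finset.mem_coe.1 hx |> Finsupp.mem_support_iff.1) (Finsupp.single_eq_of_ne h)
  exact this ▸ ho

lemma mix_symm (α : ℝ) (hα : α ∈ Set.Icc (0 : ℝ) 1) (p q : Lottery O) :
    mix α hα p q = mix (1 - α) (Set.Icc.mem_iff_one_sub_mem.1 hα) q p := by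
  apply lottery_ext
  rw [weights_mix, weights_mix, sub_sub_cancel, add_comm]

lemma Independence.mix_left_iff (hi : Independence R) {α : ℝ} (hα : α ∈ Set.Icc (0 : ℝ) 1)
    (h0 : 0 < α) (p q s : Lottery O) : R (mix α hα p s) (mix α hα q s) ↔ R p q := by
  rw [mix_symm α hα p s, mix_symm α hα q s]
  exact hi _ _ _ _ _ (by linarith)

/-- The positive multiples of differences `p - q` of lotteries with `p ≿ q`. -/
def prefCone (R : Preference O) : Set (O →₀ ℝ) :=
  {v | ∃ c : ℝ, 0 < c ∧ ∃ p q : Lottery O, R p q ∧ v = c • (p.weights - q.weights)}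

lemma sub_mem_prefCone {p q : Lottery O} (h : R p q) : p.weights - q.weights ∈ prefCone R :=
  ⟨1, one_pos, p, q, h, by simp⟩

/-- If `p - q = c (p' - q')`, then mixing `p'` with `q` and `q'` with `p`, with weight `c / (1 + c)`
on the primed lottery, gives the same lottery; Independence then transfers `p' ≿ q'` to `p ≿ q`. -/
lemma sub_mem_prefCone_iff (hi : Independence R) {p q : Lottery O} :
    p.weights - q.weights ∈ prefCone R ↔ R p q := by
  refine ⟨?_, sub_mem_prefCone⟩
  rintro ⟨c, hc, p', q', h, heq⟩
  have hα : c / (1 + c) ∈ Set.Icc (0 : ℝ) 1 :=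
    ⟨by positivity, by rw [div_le_one (by positivity)]; linarith⟩
  have hα1 : c / (1 + c) < 1 := by rw [div_lt_one (by positivity)]; linarith
  have hm : mix (c / (1 + c)) hα p' q = mix (c / (1 + c)) hα q' p := by
    apply lottery_ext
    simp only [weights_mix]
    have h1 : 1 - c / (1 + c) = (1 + c)⁻¹ := by field_simp; ring
    have hp : p.weights = q.weights + c • (p'.weights - q'.weights) := by
      rw [← heq]; abel
    rw [h1, hp, div_eq_mul_inv]
    module
  have h2 := (hi.mix_left_iff hα (by positivity) p' q' q).2 h
  rw [hm] at h2
  exact (hi _ _ _ _ hα hα1).1 h2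

lemma smul_mem_prefCone {v : O →₀ ℝ} (hv : v ∈ prefCone R) {c : ℝ} (hc : 0 < c) :
    c • v ∈ prefCone R := by
  obtain ⟨a, ha, p, q, h, rfl⟩ := hv
  exact ⟨c * a, by positivity, p, q, h, by rw [smul_smul]⟩

lemma add_mem_prefCone (ht : Transitivity R) (hi : Independence R) {v w : O →₀ ℝ}
    (hv : v ∈ prefCone R) (hw : w ∈ prefCone R) : v + w ∈ prefCone R := by
  obtain ⟨a, ha, p, q, h, rfl⟩ := hv
  obtain ⟨b, hb, p', q', h', rfl⟩ := hw
  have hα : a / (a + b) ∈ Set.Icc (0 : ℝ) 1 :=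
    ⟨by positivity, by rw [div_le_one (by positivity)]; linarith⟩
  have hα1 : a / (a + b) < 1 := by rw [div_lt_one (by positivity)]; linarith
  refine ⟨a + b, by positivity, mix _ hα p p', mix _ hα q q', ?_, ?_⟩
  · exact ht _ _ _ ((hi.mix_left_iff hα (by positivity) p q p').2 h)
      ((hi q p' q' _ hα hα1).2 h')
  · simp only [weights_mix]
    have h1 : (a + b) * (a / (a + b)) = a := by field_simp
    have h2 : (a + b) * (1 - a / (a + b)) = b := by field_simp; ring
    rw [smul_sub (a + b), smul_add, smul_add, smul_smul, smul_smul, smul_smul, smul_smul, h1, h2]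
    module

lemma Completeness.refl (hc : Completeness R) (p : Lottery O) : R p p := (hc p p).elim id id

/-- The lineality space of `prefCone R`. -/
def indiffSubmodule (hc : Completeness R) (ht : Transitivity R) (hi : Independence R) (o : O) :
    Submodule ℝ (O →₀ ℝ) where
  carrier := {v | v ∈ prefCone R ∧ -v ∈ prefCone R}
  add_mem' := by
    rintro v w ⟨h1, h2⟩ ⟨h3, h4⟩
    exact ⟨add_mem_prefCone ht hi h1 h3, neg_add v w ▸ add_mem_prefCone ht hi h2 h4⟩
  -- The outcome `o` only supplies a lottery, so that `0` is a difference of lotteries.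
  zero_mem' := by
    have : (0 : O →₀ ℝ) ∈ prefCone R := ⟨1, one_pos, dirac o, dirac o, hc.refl _, by simp⟩
    exact ⟨this, by simpa using this⟩
  smul_mem' := by
    rintro c v ⟨h1, h2⟩
    rcases lt_trichotomy c 0 with h | rfl | h
    · have e1 : c • v = (-c) • (-v) := by module
      have e2 : -(c • v) = (-c) • v := by module
      exact ⟨e1 ▸ smul_mem_prefCone h2 (by linarith), e2 ▸ smul_mem_prefCone h1 (by linarith)⟩
    · have : (0 : O →₀ ℝ) ∈ prefCone R := ⟨1, one_pos, dirac o, dirac o, hc.refl _, by simp⟩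
      exact ⟨by simpa using this, by simpa using this⟩
    · exact ⟨smul_mem_prefCone h1 h, smul_neg c v ▸ smul_mem_prefCone h2 h⟩

variable {hc : Completeness R} {ht : Transitivity R} {hi : Independence R} {o₀ : O}

lemma mem_indiffSubmodule {v : O →₀ ℝ} :
    v ∈ indiffSubmodule hc ht hi o₀ ↔ v ∈ prefCone R ∧ -v ∈ prefCone R := Iff.rfl

lemma sub_mem_indiffSubmodule {p q : Lottery O} (h : Indiff R p q) :
    p.weights - q.weights ∈ indiffSubmodule hc ht hi o₀ :=
  ⟨sub_mem_prefCone h.1, neg_sub p.weights q.weights ▸ sub_mem_prefCone h.2⟩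

lemma mem_prefCone_congr {v w : O →₀ ℝ} (h : v - w ∈ indiffSubmodule hc ht hi o₀) :
    v ∈ prefCone R ↔ w ∈ prefCone R := by
  constructor
  · intro hv
    have := add_mem_prefCone ht hi hv h.2
    rwa [show v + -(v - w) = w by abel] at this
  · intro hw
    have := add_mem_prefCone ht hi hw h.1
    rwa [show w + (v - w) = v by abel] at this

lemma half_mem_Icc : (1 / 2 : ℝ) ∈ Set.Icc (0 : ℝ) 1 := ⟨by norm_num, by norm_num⟩

/-- Continuity applied to `(a+q)/2 ≿ (b+p)/2 ≿ (b+q)/2`; the outer two differ by `(a-b)/2`, the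
lower two by `(p-q)/2`. -/
lemma exists_smul_sub_sub_mem {D : Set (Lottery O)} (hcont : ContinuityOn R D)
    (hmix : ∀ p ∈ D, ∀ q ∈ D, ∀ (α : ℝ) (hα : α ∈ Set.Icc (0 : ℝ) 1), mix α hα p q ∈ D)
    {a b p q : Lottery O} (ha : a ∈ D) (hb : b ∈ D) (hp : p ∈ D) (hq : q ∈ D) (hpq : R p q)
    (h : R (mix (1 / 2) half_mem_Icc a q)
      (mix (1 / 2) half_mem_Icc b p)) :
    ∃ α : ℝ, α • (a.weights - b.weights) - (p.weights - q.weights) ∈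
      indiffSubmodule hc ht hi o₀ := by
  obtain ⟨α, hα, hind⟩ := hcont _ (hmix a ha q hq (1 / 2) half_mem_Icc)
    _ (hmix b hb p hp (1 / 2) half_mem_Icc)
    _ (hmix b hb q hq (1 / 2) half_mem_Icc) h
    ((hi b p q _ _ (by norm_num)).2 hpq)
  refine ⟨α, ?_⟩
  have := (indiffSubmodule hc ht hi o₀).smul_mem (2 : ℝ)
    (sub_mem_indiffSubmodule (hc := hc) (ht := ht) (hi := hi) (o₀ := o₀) hind)
  convert this using 1
  simp only [weights_mix]
  module

/-- Whichever of `a - b` and `p - q` is larger can be shrunk to the other modulo indifference. If it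
is `a - b`, the factor is invertible because `p - q` is strict. -/
lemma exists_sub_smul_sub_mem {D : Set (Lottery O)} (hcont : ContinuityOn R D)
    (hmix : ∀ p ∈ D, ∀ q ∈ D, ∀ (α : ℝ) (hα : α ∈ Set.Icc (0 : ℝ) 1), mix α hα p q ∈ D)
    {a b p q : Lottery O} (ha : a ∈ D) (hb : b ∈ D) (hp : p ∈ D) (hq : q ∈ D)
    (hqp : ¬ R q p) :
    ∃ t : ℝ, (a.weights - b.weights) - t • (p.weights - q.weights) ∈
      indiffSubmodule hc ht hi o₀ := by
  wlog hab : R a b generalizing a b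
  · obtain ⟨t, h⟩ := this hb ha ((hc a b).resolve_left hab)
    refine ⟨-t, ?_⟩
    have := (indiffSubmodule hc ht hi o₀).neg_mem h
    convert this using 1
    module
  have hpq : R p q := (hc p q).resolve_right hqp
  rcases hc (mix (1 / 2) half_mem_Icc a q)
      (mix (1 / 2) half_mem_Icc b p) with h | h
  · obtain ⟨α, hα⟩ := exists_smul_sub_sub_mem (hc := hc) (ht := ht) (hi := hi) (o₀ := o₀)
      hcont hmix ha hb hp hq hpq h
    have hα0 : α ≠ 0 := by
      rintro rfl
      rw [zero_smul, zero_sub, neg_sub] at hα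
      exact hqp ((sub_mem_prefCone_iff hi).1 hα.1)
    refine ⟨α⁻¹, ?_⟩
    have := (indiffSubmodule hc ht hi o₀).smul_mem α⁻¹ hα
    rwa [smul_sub, smul_smul, inv_mul_cancel₀ hα0, one_smul] at this
  · obtain ⟨α, hα⟩ := exists_smul_sub_sub_mem (hc := hc) (ht := ht) (hi := hi) (o₀ := o₀)
      hcont hmix hp hq ha hb hab (by
        convert h using 1
        · apply lottery_ext; simp only [weights_mix]; module
        · apply lottery_ext; simp only [weights_mix]; module)
    refine ⟨α, ?_⟩
    have := (indiffSubmodule hc ht hi o₀).neg_mem hα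
    rwa [neg_sub] at this

end Cone

/-! ### The lexicographic representation of a single unsafe utility -/

section Representation

variable {O : Type*} {R : Preference O}

/-- The value of outcome `o` in `ℝ²`, given the utility `f` of the safe outcomes. -/
def lexValue (R : Preference O) (od : O) (f : O → ℝ) (o : O) : Fin 2 → ℝ :=
  open Classical in if o ∈ safeOutcomes R od then ![0, f o] else ![-1, 0]

/-- The linear extension to lotteries of a `ℝ²`-valued function of outcomes. -/
def linearUtility (v : O → Fin 2 → ℝ) (p : Lottery O) : Fin 2 → ℝ :=
  Finsupp.linearCombination ℝ v p.weights

@[simp] lemma linearUtility_dirac (v : O → Fin 2 → ℝ) (o : O) :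
    linearUtility v (dirac o) = v o := by
  simp [linearUtility]

lemma linearUtility_mix (v : O → Fin 2 → ℝ) (α : ℝ) (hα : α ∈ Set.Icc (0 : ℝ) 1)
    (p q : Lottery O) :
    linearUtility v (mix α hα p q) = α • linearUtility v p + (1 - α) • linearUtility v q := by
  simp [linearUtility]

lemma isLinearUtility_linearUtility (v : O → Fin 2 → ℝ) : IsLinearUtility (linearUtility v) := by
  intro p
  simp only [linearUtility_dirac]
  rfl

lemma IsLinearUtility.eq_linearUtility {u : Lottery O → Fin 2 → ℝ} (hu : IsLinearUtility u) :
    u = linearUtility fun o => u (dirac o) :=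
  funext hu

lemma IsLexUtility.indiff_iff {u : Lottery O → Fin 2 → ℝ} (hu : IsLexUtility R u)
    (p q : Lottery O) : Indiff R p q ↔ u p = u q := by
  rw [Indiff, ← hu, ← hu]
  constructor
  · rintro ⟨h1, h2⟩
    exact toLex.injective (le_antisymm h2 h1)
  · intro h
    rw [h]
    exact ⟨le_rfl, le_rfl⟩

lemma linearCombination_one_weights (p : Lottery O) :
    Finsupp.linearCombination ℝ (fun _ : O => (1 : ℝ)) p.weights = 1 := by
  rw [Finsupp.linearCombination_apply]
  simp

/-- Safety First in the form: no multiple of a difference of safe outcomes outweighs the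
difference of a safe outcome and the unsafe one. -/
lemma SafetyFirst.strict_mix {od : O} (hs : SafetyFirst R od) {a b c : O}
    (ha : a ∈ safeOutcomes R od) (hb : b ∈ safeOutcomes R od) (hc : c ∈ safeOutcomes R od)
    {α : ℝ} (hα : α ∈ Set.Icc (0 : ℝ) 1) (h0 : 0 < α) :
    ¬ R (mix α hα (dirac od) (dirac c)) (mix α hα (dirac a) (dirac b)) :=
  hs _ (dirac_mem_lotteriesOn hc) _
    (mix_mem_lotteriesOn (dirac_mem_lotteriesOn ha) (dirac_mem_lotteriesOn hb)) α hα h0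

/-- For `t ≥ 0`, dividing by `1 + t` turns the vector into a difference of two mixtures with weight
`1 / (1 + t)`, the second charging `od`. Negative `t` swaps `b` and `c`. -/
lemma SafetyFirst.add_smul_mem_prefCone {od : O} (hs : SafetyFirst R od)
    (hcomp : Completeness R) (hi : Independence R) {a b c : O}
    (ha : a ∈ safeOutcomes R od) (hb : b ∈ safeOutcomes R od) (hc : c ∈ safeOutcomes R od)
    (t : ℝ) :
    ((dirac a).weights - (dirac od).weights) + t • ((dirac b).weights - (dirac c).weights) ∈
        prefCone R ∧
      -(((dirac a).weights - (dirac od).weights) +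
        t • ((dirac b).weights - (dirac c).weights)) ∉ prefCone R := by
  wlog htn : 0 ≤ t generalizing b c t
  · have := this hc hb (-t) (by linarith)
    rwa [neg_smul, ← smul_neg, neg_sub] at this
  have hα : 1 / (1 + t) ∈ Set.Icc (0 : ℝ) 1 :=
    ⟨by positivity, by rw [div_le_one (by positivity)]; linarith⟩
  have hneg := hs.strict_mix ha hb hc hα (by positivity)
  have key : (mix _ hα (dirac a) (dirac b)).weights - (mix _ hα (dirac od) (dirac c)).weights =
      (1 / (1 + t)) • (((dirac a).weights - (dirac od).weights) +
        t • ((dirac b).weights - (dirac c).weights)) := by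
    rw [weights_mix, weights_mix]
    have h1 : 1 - 1 / (1 + t) = 1 / (1 + t) * t := by field_simp; ring
    rw [h1]
    module
  have key' := congrArg (fun x => (1 + t) • x) key
  simp only [smul_smul] at key'
  rw [mul_one_div_cancel (by positivity), one_smul] at key'
  constructor
  · rw [← key']
    exact smul_mem_prefCone (sub_mem_prefCone ((hcomp _ _).resolve_right hneg)) (by positivity)
  · intro hmem
    apply hneg
    rw [← sub_mem_prefCone_iff hi, ← neg_sub, key, ← smul_neg]
    exact smul_mem_prefCone hmem (by positivity)

lemma smul_add_smul_mem_prefCone_iff (ht : Transitivity R) (hcomp : Completeness R)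
    (o : O) (hi : Independence R) {b d : O →₀ ℝ}
    (hd : d ∈ prefCone R) (hd' : -d ∉ prefCone R)
    (hb : ∀ t : ℝ, b + t • d ∈ prefCone R ∧ -(b + t • d) ∉ prefCone R) (s t : ℝ) :
    s • b + t • d ∈ prefCone R ↔ 0 < s ∨ (0 = s ∧ 0 ≤ t) := by
  have hscale : ∀ s : ℝ, s ≠ 0 → s • b + t • d = s • (b + (t / s) • d) := by
    intro s hs
    rw [smul_add, smul_smul, mul_div_cancel₀ _ hs]
  rcases lt_trichotomy s 0 with hs | rfl | hs
  · refine iff_of_false ?_ (by rintro (h | ⟨h, -⟩) <;> linarith)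
    intro hmem
    rw [hscale s hs.ne] at hmem
    have := smul_mem_prefCone hmem (c := (-s)⁻¹) (inv_pos.2 (by linarith))
    rw [smul_smul, inv_neg, neg_mul, inv_mul_cancel₀ hs.ne, neg_one_smul] at this
    exact (hb _).2 this
  · simp only [zero_smul, zero_add, lt_irrefl, true_and, false_or]
    rcases lt_trichotomy t 0 with h | rfl | h
    · refine iff_of_false ?_ (by linarith)
      intro hmem
      have := smul_mem_prefCone hmem (c := (-t)⁻¹) (inv_pos.2 (by linarith))
      rw [smul_smul, inv_neg, neg_mul, inv_mul_cancel₀ h.ne, neg_one_smul] at this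
      exact hd' this
    · refine iff_of_true ?_ le_rfl
      rw [zero_smul]
      exact (indiffSubmodule hcomp ht hi o).zero_mem.1
    · exact iff_of_true (smul_mem_prefCone hd h) h.le
  · refine iff_of_true ?_ (Or.inl hs)
    rw [hscale s hs.ne']
    exact smul_mem_prefCone (hb _).1 hs

lemma SingleUnsafe.exists_lexUtility {od o₀ : O} (h : SingleUnsafe R od)
    (h₀ : o₀ ∈ safeOutcomes R od) :
    ∃ f : O → ℝ, ∃ o₁ ∈ safeOutcomes R od, ∃ o₂ ∈ safeOutcomes R od,
      ¬ R (dirac o₂) (dirac o₁) ∧ f o₀ = 0 ∧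
      IsLexUtility R (linearUtility (lexValue R od f)) ∧
      ∀ o ∈ safeOutcomes R od,
        ((dirac o).weights - (dirac o₀).weights) -
          f o • ((dirac o₁).weights - (dirac o₂).weights) ∈
            indiffSubmodule h.complete h.trans h.indep o₀ := by
  obtain ⟨o₁, h₁, o₂, h₂, h12⟩ : ∃ o₁ ∈ safeOutcomes R od, ∃ o₂ ∈ safeOutcomes R od,
      ¬ R (dirac o₂) (dirac o₁) := by
    obtain ⟨o₁, h₁, o₂, h₂, hne⟩ := h.nontrivial
    by_cases h21 : R (dirac o₂) (dirac o₁)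
    · exact ⟨o₂, h₂, o₁, h₁, fun h12 => hne ⟨h12, h21⟩⟩
    · exact ⟨o₁, h₁, o₂, h₂, h21⟩
  set L := indiffSubmodule h.complete h.trans h.indep o₀ with hL
  set d := (dirac o₁).weights - (dirac o₂).weights with hd_def
  set b := (dirac o₀).weights - (dirac od).weights with hb_def
  have hd : d ∈ prefCone R := sub_mem_prefCone ((h.complete _ _).resolve_right h12)
  have hd' : -d ∉ prefCone R := by
    rwa [hd_def, neg_sub, sub_mem_prefCone_iff h.indep]
  -- The coordinate along `d` is chosen for all outcomes at once; its value at unsafe ones is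
  -- ignored by `lexValue`.
  have hex : ∀ o, ∃ t : ℝ, o ∈ safeOutcomes R od →
      ((dirac o).weights - (dirac o₀).weights) - t • d ∈ L := by
    intro o
    by_cases ho : o ∈ safeOutcomes R od
    · obtain ⟨t, ht⟩ := exists_sub_smul_sub_mem (hc := h.complete) (ht := h.trans)
        (hi := h.indep) (o₀ := o₀) h.cont_safe
        (fun p hp q hq α hα => mix_mem_lotteriesOn hp hq) (dirac_mem_lotteriesOn ho)
        (dirac_mem_lotteriesOn h₀) (dirac_mem_lotteriesOn h₁) (dirac_mem_lotteriesOn h₂) h12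
      exact ⟨t, fun _ => ht⟩
    · exact ⟨0, fun h' => absurd h' ho⟩
  choose f hf using hex
  have hf0 : f o₀ = 0 := by
    by_contra hne
    have := L.smul_mem (f o₀)⁻¹ (hf o₀ h₀)
    rw [sub_self, zero_sub, smul_neg, smul_smul, inv_mul_cancel₀ hne, one_smul] at this
    exact hd' this.1
  refine ⟨f, o₁, h₁, o₂, h₂, h12, hf0, ?_, fun o ho => hf o ho⟩
  set U := Finsupp.linearCombination ℝ (lexValue R od f) with hU
  set mass := Finsupp.linearCombination ℝ (fun _ : O => (1 : ℝ)) with hmass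
  -- The `mass` term makes the statement linear in `v`, so it need only be checked on Dirac masses;
  -- it vanishes on differences of lotteries.
  have hred : ∀ v : O →₀ ℝ,
      v - mass v • (dirac o₀).weights - (U v 0 • b + U v 1 • d) ∈ L := by
    intro v
    induction v using Finsupp.induction_linear with
    | zero => simp
    | add v w hv hw =>
      convert L.add_mem hv hw using 1
      simp only [map_add, Pi.add_apply]
      module
    | single o c =>
      have hval : (dirac o).weights - (dirac o₀).weights -
          (lexValue R od f o 0 • b + lexValue R od f o 1 • d) ∈ L := by
        by_cases ho : o ∈ safeOutcomes R od
        · simpa [lexValue, ho] using hf o ho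
        · have hind : Indiff R (dirac o) (dirac od) := not_not.1 ho
          have hmem := sub_mem_indiffSubmodule (hc := h.complete) (ht := h.trans)
            (hi := h.indep) (o₀ := o₀) hind
          convert hmem using 1
          simp only [lexValue, ho, if_false, hb_def, Matrix.cons_val_zero, Matrix.cons_val_one]
          module
      convert L.smul_mem c hval using 1
      have e : Finsupp.single o c = c • (dirac o).weights := by simp
      rw [e, map_smul, map_smul, hU, hmass, weights_dirac, weights_dirac,
        Finsupp.linearCombination_single, Finsupp.linearCombination_single]
      simp only [Pi.smul_apply, smul_eq_mul, one_mul]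
      module
  intro p q
  rw [toLex_ge_iff, ← sub_mem_prefCone_iff h.indep]
  have hpq := hred (p.weights - q.weights)
  rw [map_sub mass, hmass, linearCombination_one_weights, linearCombination_one_weights,
    sub_self, zero_smul, sub_zero] at hpq
  rw [mem_prefCone_congr hpq, smul_add_smul_mem_prefCone_iff h.trans h.complete o₀ h.indep hd hd'
    (fun t => h.safety.add_smul_mem_prefCone h.complete h.indep h₀ h₁ h₂ t)]
  simp only [map_sub, Pi.sub_apply, sub_pos, sub_nonneg, eq_comm (a := (0 : ℝ)), sub_eq_zero]
  simp only [linearUtility, eq_comm (a := U q.weights 0), ← hU]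

end Representation

/-! ### From Memorylessness to the recursion -/

section Recursion

variable {E : Type*} {R : Preference (List E)} {od : List E}

@[simp] lemma prepend_dirac (e : E) (τ : List E) : prepend e (dirac τ) = dirac (e :: τ) :=
  StdSimplex.map_single _ _

lemma weights_prepend (e : E) (p : Lottery (List E)) :
    (prepend e p).weights = p.weights.mapDomain (List.cons e) := rfl

lemma prepend_mix (e : E) (α : ℝ) (hα : α ∈ Set.Icc (0 : ℝ) 1) (p q : Lottery (List E)) :
    prepend e (mix α hα p q) = mix α hα (prepend e p) (prepend e q) := by
  apply lottery_ext
  simp [weights_prepend, Finsupp.mapDomain_add, Finsupp.mapDomain_smul]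

lemma linearUtility_prepend (v : List E → Fin 2 → ℝ) (e : E) (p : Lottery (List E)) :
    linearUtility v (prepend e p) = linearUtility (fun τ => v (e :: τ)) p := by
  simp [linearUtility, weights_prepend, Finsupp.linearCombination_mapDomain, Function.comp_def]

lemma lexValue_of_mem {f : List E → ℝ} {o : List E} (h : o ∈ safeOutcomes R od) :
    lexValue R od f o = ![0, f o] := if_pos h

lemma lexValue_of_notMem {f : List E → ℝ} {o : List E} (h : o ∉ safeOutcomes R od) :
    lexValue R od f o = ![-1, 0] := if_neg h

lemma od_notMem_safeOutcomes (hc : Completeness R) : od ∉ safeOutcomes R od :=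
  not_not.2 ⟨hc.refl _, hc.refl _⟩

lemma Retains.mapDomain_mem_prefCone {e : E} (he : Retains R e) {v : List E →₀ ℝ}
    (hv : v ∈ prefCone R) : v.mapDomain (List.cons e) ∈ prefCone R := by
  obtain ⟨c, hc, p, q, h, rfl⟩ := hv
  refine ⟨c, hc, prepend e p, prepend e q, (he p q).2 h, ?_⟩
  rw [Finsupp.mapDomain_smul, weights_prepend, weights_prepend]
  congr 1
  exact map_sub (Finsupp.mapDomain.addMonoidHom (List.cons e)) p.weights q.weights

lemma linearCombination_eq_zero_of_mem {O : Type*} {R : Preference O} (hi : Independence R)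
    {w : O → Fin 2 → ℝ} (hw : IsLexUtility R (linearUtility w)) {v : O →₀ ℝ}
    (h : v ∈ prefCone R) (h' : -v ∈ prefCone R) : Finsupp.linearCombination ℝ w v = 0 := by
  obtain ⟨c, hc, p, q, hpq, rfl⟩ := h
  have hqp : R q p := by
    rw [← sub_mem_prefCone_iff hi]
    have := smul_mem_prefCone h' (inv_pos.2 hc)
    rwa [smul_neg, smul_smul, inv_mul_cancel₀ hc.ne', one_smul, neg_sub] at this
  have := (hw.indiff_iff p q).1 ⟨hpq, hqp⟩
  unfold linearUtility at this
  rw [map_smul, map_sub, this, sub_self, smul_zero]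

/-- The sequence `[e]` already has the least value `(-1, 0)`, so `e·o†` cannot be strictly worse
than `e·ε`, although `o†` is strictly worse than `ε`. -/
lemma not_retains_of_mem_unsafeEvents (hc : Completeness R) {f : List E → ℝ}
    (hu : IsLexUtility R (linearUtility (lexValue R od f)))
    (hnil : [] ∈ safeOutcomes R od) {e : E} (he : e ∈ unsafeEvents R od) : ¬ Retains R e := by
  intro hr
  have hlt : ¬ R (dirac od) (dirac []) := by
    rw [← hu, toLex_ge_iff]
    simp [lexValue_of_mem hnil, lexValue_of_notMem (od_notMem_safeOutcomes hc)]
  apply hlt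
  rw [← hr, prepend_dirac, prepend_dirac, ← hu, toLex_ge_iff]
  have h1 : lexValue R od f [e] = ![-1, 0] := lexValue_of_notMem (not_not.2 he)
  by_cases h : e :: od ∈ safeOutcomes R od
  · simp [h1, lexValue_of_mem h]
  · simp [h1, lexValue_of_notMem h]

/-- A retaining event leads from the unsafe outcome to an unsafe outcome. -/
lemma Retains.cons_od_notMem (hc : Completeness R) {f : List E → ℝ}
    (hu : IsLexUtility R (linearUtility (lexValue R od f))) {o₀ o₁ o₂ : List E}
    (h₀ : o₀ ∈ safeOutcomes R od) (h₁ : o₁ ∈ safeOutcomes R od) (h₂ : o₂ ∈ safeOutcomes R od)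
    {e : E} (he : Retains R e) (h₀' : e :: o₀ ∈ safeOutcomes R od)
    (h₁' : e :: o₁ ∈ safeOutcomes R od) (h₂' : e :: o₂ ∈ safeOutcomes R od)
    (hlt : f (e :: o₂) < f (e :: o₁)) : e :: od ∉ safeOutcomes R od := by
  intro hod
  have hod' := lexValue_of_notMem (f := f) (od_notMem_safeOutcomes (R := R) (od := od) hc)
  -- If `e·o†` were safe, the strict penalty for `od` would become an inequality between real
  -- utilities, which fails for small `α`.
  have key : ∀ α : ℝ, α ∈ Set.Icc (0 : ℝ) 1 → 0 < α →
      α * f (e :: od) + (1 - α) * f (e :: o₁) ≤ α * f (e :: o₀) + (1 - α) * f (e :: o₂) := by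
    intro α hα h0
    have h : R (mix α hα (dirac o₀) (dirac o₂)) (mix α hα (dirac od) (dirac o₁)) := by
      rw [← hu, toLex_ge_iff]
      left
      simp [linearUtility_mix, lexValue_of_mem h₀, lexValue_of_mem h₁, lexValue_of_mem h₂, hod',
        h0]
    rw [← he, ← hu, toLex_ge_iff] at h
    simpa [linearUtility_mix, prepend_mix, lexValue_of_mem h₀', lexValue_of_mem h₁',
      lexValue_of_mem h₂', lexValue_of_mem hod] using h
  set g := f (e :: o₁) - f (e :: o₂) with hg
  have hgpos : 0 < g := sub_pos.2 hlt
  set K := f (e :: o₀) - f (e :: od) with hK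
  -- This `α` satisfies `α (g + |K|) = g / 2 < g`, against `(1 - α) g ≤ α K`.
  have hden : 0 < 2 * (g + |K|) := by positivity
  have hα0 : 0 < g / (2 * (g + |K|)) := by positivity
  have hα1 : g / (2 * (g + |K|)) ≤ 1 := by
    rw [div_le_one hden]
    linarith [abs_nonneg K]
  have h := key _ ⟨hα0.le, hα1⟩ hα0
  set α := g / (2 * (g + |K|)) with hα
  have hmul : α * (g + |K|) = g / 2 := by
    rw [hα]
    field_simp
  have hKle : α * K ≤ α * |K| := mul_le_mul_of_nonneg_left (le_abs_self K) hα0.le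
  have : (1 - α) * g ≤ α * K := by rw [hg, hK]; linarith
  linarith

theorem SingleUnsafe.exists_recursive_utility (h : SingleUnsafe R od) (hm : Memorylessness R)
    (hnil : [] ∈ safeOutcomes R od) :
    ∃ (r γ : E → ℝ) (u : Lottery (List E) → Fin 2 → ℝ),
      (∀ e, 0 < γ e) ∧ IsLinearUtility u ∧ IsLexUtility R u ∧
      u (dirac []) = 0 ∧ u (dirac od) = ![-1, 0] ∧
      (∃ o₁ ∈ safeOutcomes R od, ∃ o₂ ∈ safeOutcomes R od, u (dirac o₁) ≠ u (dirac o₂)) ∧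
      SafeRecursion R od r γ u := by
  classical
  obtain ⟨f, o₁, h₁, o₂, h₂, h12, hf0, hu, hL⟩ := h.exists_lexUtility hnil
  have hval : ∀ o o', Indiff R (dirac o) (dirac o') →
      lexValue R od f o = lexValue R od f o' := by
    intro o o' hi
    simpa using (hu.indiff_iff _ _).1 hi
  have hod := lexValue_of_notMem (f := f) (od_notMem_safeOutcomes (od := od) h.complete)
  refine ⟨fun e => f [e],
    fun e => if f (e :: o₂) < f (e :: o₁) then f (e :: o₁) - f (e :: o₂) else 1,
    linearUtility (lexValue R od f), ?_, isLinearUtility_linearUtility _, hu, ?_, ?_, ?_, ?_⟩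
  · intro e
    dsimp only
    split_ifs with hlt
    · exact sub_pos.2 hlt
    · exact one_pos
  · rw [linearUtility_dirac, lexValue_of_mem hnil, hf0]
    ext i
    fin_cases i <;> rfl
  · rw [linearUtility_dirac, hod]
  · refine ⟨o₁, h₁, o₂, h₂, fun heq => h12 ?_⟩
    exact ((hu.indiff_iff _ _).2 heq).2
  intro e τ
  simp only [linearUtility_dirac]
  refine ⟨?_, ?_, ?_⟩
  · rintro ⟨hterm, hsafe⟩
    have hi := hterm (dirac τ) (dirac [])
    rw [prepend_dirac, prepend_dirac] at hi
    rw [hval _ _ hi, lexValue_of_mem (show [e] ∈ safeOutcomes R od from hsafe)]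
  · intro he
    have hterm := (hm e).resolve_left (not_retains_of_mem_unsafeEvents h.complete hu hnil he)
    have hi := hterm (dirac τ) (dirac [])
    rw [prepend_dirac, prepend_dirac] at hi
    rw [hval _ _ hi, hval _ _ he, hod]
  · rintro ⟨hterm, hsafe⟩
    have he : Retains R e := (hm e).resolve_right hterm
    -- Otherwise `e·σ` has the least value, so `e·o† ≿ e·σ`, and retention gives `o† ≿ σ`.
    have hcons : ∀ σ ∈ safeOutcomes R od, e :: σ ∈ safeOutcomes R od := by
      intro σ hσ hi
      have hlt : ¬ R (dirac od) (dirac σ) := by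
        rw [← hu, toLex_ge_iff]
        simp [lexValue_of_mem hσ, hod]
      apply hlt
      rw [← he, prepend_dirac, prepend_dirac, ← hu, toLex_ge_iff]
      simp only [linearUtility_dirac]
      rw [hval _ _ hi, hod]
      by_cases h' : e :: od ∈ safeOutcomes R od
      · simp [lexValue_of_mem h']
      · simp [lexValue_of_notMem h']
    have hlt : f (e :: o₂) < f (e :: o₁) := by
      have h12' : ¬ R (dirac (e :: o₂)) (dirac (e :: o₁)) := by
        rwa [← prepend_dirac, ← prepend_dirac, he]
      rw [← hu, toLex_ge_iff] at h12'
      simpa [lexValue_of_mem (hcons _ h₁), lexValue_of_mem (hcons _ h₂)] using h12'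
    have hcod := he.cons_od_notMem h.complete hu hnil h₁ h₂ (hcons _ hnil) (hcons _ h₁)
      (hcons _ h₂) hlt
    rw [if_pos hlt]
    by_cases hτ : τ ∈ safeOutcomes R od
    -- The prepended indifference relation has utility zero; its second coordinate is the recursion.
    · have hmem := hL τ hτ
      have hz := linearCombination_eq_zero_of_mem h.indep hu
        (he.mapDomain_mem_prefCone hmem.1) (by
          have := he.mapDomain_mem_prefCone hmem.2
          rwa [show ∀ x : List E →₀ ℝ, Finsupp.mapDomain (List.cons e) (-x) =
            -Finsupp.mapDomain (List.cons e) x from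
            map_neg (Finsupp.mapDomain.addMonoidHom (List.cons e))] at this)
      rw [Finsupp.linearCombination_mapDomain] at hz
      have hz1 := congrFun hz 1
      simp [lexValue_of_mem (hcons _ h₁), lexValue_of_mem (hcons _ h₂),
        lexValue_of_mem (hcons _ hτ), lexValue_of_mem (hcons _ hnil)] at hz1
      rw [lexValue_of_mem (hcons _ hτ), lexValue_of_mem hτ]
      ext i
      fin_cases i
      · rfl
      · simp
        linarith
    · have hi : Indiff R (dirac τ) (dirac od) := not_not.1 hτ
      have hi' : Indiff R (dirac (e :: τ)) (dirac (e :: od)) := by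
        rw [← prepend_dirac, ← prepend_dirac]
        exact ⟨(he _ _).2 hi.1, (he _ _).2 hi.2⟩
      rw [hval _ _ hi', lexValue_of_notMem hcod, lexValue_of_notMem hτ]
      ext i
      fin_cases i <;> simp

end Recursion

/-! ### From the recursive utility back to the axioms -/

section Converse

variable {O : Type*} {R : Preference O} {v : O → Fin 2 → ℝ}

lemma linearUtility_zero_of_mem {S : Set O} (hv : ∀ o ∈ S, v o 0 = 0) {p : Lottery O}
    (hp : p ∈ lotteriesOn S) : linearUtility v p 0 = 0 := by
  rw [linearUtility, Finsupp.linearCombination_apply, Finsupp.sum, Finset.sum_apply]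
  refine Finset.sum_eq_zero fun o ho => ?_
  simp [hv o (hp ho)]

lemma IsLexUtility.independence (hu : IsLexUtility R (linearUtility v)) : Independence R := by
  intro p q s α hα h1
  rw [← hu, ← hu, toLex_ge_iff, toLex_ge_iff, linearUtility_mix, linearUtility_mix]
  have h : 0 < 1 - α := by linarith
  simp [h, h.ne']

lemma IsLexUtility.singleUnsafe {od : O} (hu : IsLexUtility R (linearUtility v))
    (hod : v od = ![-1, 0]) (hv : ∀ o ∈ safeOutcomes R od, v o 0 = 0)
    (hne : ∃ o₁ ∈ safeOutcomes R od, ∃ o₂ ∈ safeOutcomes R od, v o₁ ≠ v o₂) :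
    SingleUnsafe R od where
  complete p q := by
    rw [← hu, ← hu]
    exact le_total _ _
  trans p q s := by
    rw [← hu, ← hu, ← hu]
    exact fun h1 h2 => le_trans h2 h1
  indep := hu.independence
  cont_safe p hp q hq s hs hpq hqs := by
    have hp0 := linearUtility_zero_of_mem hv hp
    have hq0 := linearUtility_zero_of_mem hv hq
    have hs0 := linearUtility_zero_of_mem hv hs
    rw [← hu, toLex_ge_iff, hp0, hq0] at hpq
    rw [← hu, toLex_ge_iff, hq0, hs0] at hqs
    simp only [lt_irrefl, true_and, false_or] at hpq hqs
    have hmem : linearUtility v q 1 ∈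
        segment ℝ (linearUtility v s 1) (linearUtility v p 1) := by
      rw [segment_eq_Icc (hqs.trans hpq)]
      exact ⟨hqs, hpq⟩
    obtain ⟨a, α, ha, hα, hsum, heq⟩ := hmem
    have haα : a = 1 - α := by linarith
    have hαI : α ∈ Set.Icc (0 : ℝ) 1 := ⟨hα, by linarith⟩
    refine ⟨α, hαI, ?_⟩
    rw [hu.indiff_iff, linearUtility_mix]
    ext i
    fin_cases i
    · simp [hp0, hq0, hs0]
    · simp only [← heq, haα, smul_eq_mul, Fin.mk_one, Pi.add_apply, Pi.smul_apply]
      ring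
  safety p hp q hq ε hε h0 := by
    rw [Strict, ← hu, toLex_ge_iff, linearUtility_mix]
    simp [linearUtility_zero_of_mem hv hp, linearUtility_zero_of_mem hv hq, hod, h0.le, h0.ne']
  nontrivial := by
    obtain ⟨o₁, h₁, o₂, h₂, hne⟩ := hne
    refine ⟨o₁, h₁, o₂, h₂, ?_⟩
    rwa [hu.indiff_iff, linearUtility_dirac, linearUtility_dirac]

lemma linearUtility_affine {w : O → Fin 2 → ℝ} {r c : ℝ}
    (hw : ∀ o, w o = ![v o 0, (1 + v o 0) * r + c * v o 1]) (p : Lottery O) :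
    linearUtility w p =
      ![linearUtility v p 0, (1 + linearUtility v p 0) * r + c * linearUtility v p 1] := by
  -- Replacing the constant `1` by the total mass makes the identity linear, hence provable by
  -- induction on `x`.
  have key : ∀ x : O →₀ ℝ, Finsupp.linearCombination ℝ w x =
      ![Finsupp.linearCombination ℝ v x 0,
        (Finsupp.linearCombination ℝ (fun _ => (1 : ℝ)) x + Finsupp.linearCombination ℝ v x 0) * r +
          c * Finsupp.linearCombination ℝ v x 1] := by
    intro x
    induction x using Finsupp.induction_linear with
    | zero => ext i; fin_cases i <;> simp
    | add x y hx hy =>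
      rw [map_add, hx, hy]
      ext i
      fin_cases i
      · simp
      · simp
        ring
    | single o a =>
      ext i
      fin_cases i
      · simp [hw]
      · simp [hw]
        ring
  rw [linearUtility, key, linearCombination_one_weights]
  rfl

variable {E : Type*} {R : Preference (List E)} {od : List E}

lemma SafeRecursion.value_cases {r γ : E → ℝ} {u : Lottery (List E) → Fin 2 → ℝ}
    (hrec : SafeRecursion R od r γ u) (hnil : u (dirac []) = 0) (τ : List E) :
    u (dirac τ) 0 = 0 ∨ u (dirac τ) = ![-1, 0] := by
  induction τ with
  | nil => left; rw [hnil]; rfl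
  | cons e τ ih =>
    obtain ⟨h1, h2, h3⟩ := hrec e τ
    by_cases hun : e ∈ unsafeEvents R od
    · exact Or.inr (h2 hun)
    by_cases hterm : e ∈ terminalEvents R
    · left
      rw [h1 ⟨hterm, hun⟩]
      rfl
    rw [h3 ⟨hterm, hun⟩]
    rcases ih with ih | ih
    · left
      exact ih
    · right
      rw [ih]
      ext i
      fin_cases i <;> simp

lemma SafeRecursion.memorylessness {v : List E → Fin 2 → ℝ} {r γ : E → ℝ}
    (hu : IsLexUtility R (linearUtility v)) (hγ : ∀ e, 0 < γ e)
    (hrec : SafeRecursion R od r γ (linearUtility v)) : Memorylessness R := by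
  intro e
  by_cases hterm : e ∈ terminalEvents R
  · exact Or.inr hterm
  left
  by_cases hun : e ∈ unsafeEvents R od
  -- An unsafe event gives every continuation the value `(-1, 0)`, so it is terminal.
  · refine absurd ?_ hterm
    have hconst : (fun τ => v (e :: τ)) = fun _ => ![-1, 0] := by
      funext τ
      simpa using (hrec e τ).2.1 hun
    intro p q
    rw [hu.indiff_iff, linearUtility_prepend, linearUtility_prepend, hconst]
    have : ∀ p : Lottery (List E), linearUtility (fun _ : List E => ![(-1 : ℝ), 0]) p =
        ![-1, 0] := by
      intro p
      rw [linearUtility, Finsupp.linearCombination_apply, Finsupp.sum, ← Finset.sum_smul]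
      rw [show ∑ i ∈ p.weights.support, p.weights i = 1 from p.total, one_smul]
    rw [this, this]
  · intro p q
    have haff := linearUtility_affine (v := v) (w := fun τ => v (e :: τ)) (r := r e) (c := γ e)
      (fun τ => by simpa using (hrec e τ).2.2 ⟨hterm, hun⟩)
    rw [← hu, ← hu, toLex_ge_iff, toLex_ge_iff, linearUtility_prepend, linearUtility_prepend,
      haff, haff]
    simp only [Matrix.cons_val_zero, Matrix.cons_val_one]
    -- At equal first coordinates the shifts by `r e` agree, and `γ e > 0` preserves the order.
    refine or_congr_right (and_congr_right fun h => ?_)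
    rw [h, add_le_add_iff_left, mul_le_mul_iff_right₀ (hγ e)]

end Converse

end LexEUT

end

theorem mainTheorem4 {E : Type*} (R : LexEUT.Preference (List E)) (od : List E)
    (hsafe : [] ∈ LexEUT.safeOutcomes R od) :
    (LexEUT.SingleUnsafe R od ∧ LexEUT.Memorylessness R) ↔
      ∃ (r : E → ℝ) (γ : E → ℝ) (u : LexEUT.Lottery (List E) → Fin 2 → ℝ),
        (∀ e, 0 < γ e) ∧
        LexEUT.IsLinearUtility u ∧
        LexEUT.IsLexUtility R u ∧
        u (LexEUT.dirac []) = 0 ∧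
        u (LexEUT.dirac od) = ![-1, 0] ∧
        (∃ o₁ ∈ LexEUT.safeOutcomes R od, ∃ o₂ ∈ LexEUT.safeOutcomes R od,
          u (LexEUT.dirac o₁) ≠ u (LexEUT.dirac o₂)) ∧
        LexEUT.SafeRecursion R od r γ u := by
  constructor
  · rintro ⟨h, hm⟩
    exact h.exists_recursive_utility hm hsafe
  · rintro ⟨r, γ, u, hγ, hlin, hu, hnil, hod, hne, hrec⟩
    obtain ⟨v, rfl⟩ : ∃ v, u = LexEUT.linearUtility v := ⟨_, hlin.eq_linearUtility⟩
    refine ⟨hu.singleUnsafe (by simpa using hod) ?_ (by simpa using hne),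
      LexEUT.SafeRecursion.memorylessness hu hγ hrec⟩
    intro o ho
    rcases hrec.value_cases hnil o with h | h
    · simpa using h
    · exact absurd ((hu.indiff_iff _ _).2 (h.trans hod.symm)) ho
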